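/- Let $\mathfrak{g}$ be a finite-dimensional complex Lie algebra. For $f\in\mathfrak{g}^{*}$ let $\mathfrak{g}_{f}=\{x\in\mathfrak{g} : f([x,y])=0 \text{ for all } y\in\mathfrak{g}\}$ be its stabilizer for the coadjoint action, and let the index of $\mathfrak{g}$ be $\chi[\mathfrak{g}]=\min\{\dim\mathfrak{g}_{f} : f\in\mathfrak{g}^{*}\}$. For a composition $(a_{1},\ldots,a_{m})$ of an integer $n\geq 1$ (that is, $a_1,\ldots,a_m$ are positive integers with sum $n$), let $\mathfrak{p}(a_{1},\ldots,a_{m})$ be the parabolic subalgebra of $\mathfrak{gl}(n)=\mathfrak{gl}_n(\mathbb{C})$ consisting of the block upper triangular matrices with successive diagonal blocks of sizes $a_{1},\ldots,a_{m}$. Then for all integers $a>1$ and $k\geq 0$, $$\chi[\mathfrak{p}(1,a,a^{2},\ldots,a^{k})]=\frac{a^{\lfloor k/2\rfloor+1}-1}{a-1}.$$ -/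

import Mathlib

attribute [local instance 100] LieRing.ofAssociativeRing

namespace LieIndex

/-- The stabilizer `{x ∈ L | f([x, y]) = 0 for all y ∈ L}` of a linear form `f` under the
coadjoint action. -/
def stabilizer {K L : Type*} [Field K] [LieRing L] [LieAlgebra K L] (f : Module.Dual K L) :
    LieSubalgebra K L where
  carrier := {x | ∀ y, f ⁅x, y⁆ = 0}
  zero_mem' := by intro y; simp
  add_mem' := by
    intro u v hu hv y
    rw [add_lie, map_add, hu y, hv y, add_zero]
  smul_mem' := by
    intro t u hu y
    rw [smul_lie, map_smul, hu y, smul_zero]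
  lie_mem' := by
    intro u v hu hv y
    rw [lie_lie, map_sub, hu, hv, sub_zero]

/-- The index of a finite-dimensional Lie algebra: the minimal dimension of the stabilizer of a
linear form (an infimum over a nonempty set of natural numbers, hence attained). -/
noncomputable def index (K L : Type*) [Field K] [LieRing L] [LieAlgebra K L]
    [FiniteDimensional K L] : ℕ :=
  ⨅ f : Module.Dual K L, Module.finrank K (stabilizer f)

/-- The standard parabolic subalgebra of `gl(n)` attached to a composition `c` of `n`: the block
upper triangular matrices whose successive diagonal blocks have the sizes of the blocks of `c`
(`c.index i` is the block that contains `i`). -/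
def parabolic (K : Type*) [Field K] {n : ℕ} (c : Composition n) :
    LieSubalgebra K (Matrix (Fin n) (Fin n) K) where
  carrier := {M | M.BlockTriangular c.index}
  zero_mem' := Matrix.blockTriangular_zero
  add_mem' := by
    intro M N hM hN
    exact Matrix.BlockTriangular.add hM hN
  smul_mem' := by
    intro t M hM i j hij
    rw [Matrix.smul_apply, hM hij, smul_zero]
  lie_mem' := by
    intro M N hM hN
    rw [Ring.lie_def]
    exact (Matrix.BlockTriangular.mul hM hN).sub (Matrix.BlockTriangular.mul hN hM)

/-- The composition `(1, a, a ^ 2, …, a ^ k)` of `1 + a + a ^ 2 + ⋯ + a ^ k`. -/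
def powerComposition (a k : ℕ) (ha : 1 < a) :
    Composition ((List.range (k + 1)).map (fun i => a ^ i)).sum where
  blocks := (List.range (k + 1)).map (fun i => a ^ i)
  blocks_pos := by
    intro m hm
    obtain ⟨i, -, rfl⟩ := List.mem_map.1 hm
    exact pow_pos (by omega) i
  blocks_sum := rfl

end LieIndex

namespace LieIndex

open Module Filter Matrix

/-! ### Generic linear forms and reduction of the form `f ⁅·, ·⁆`. -/

section General

variable {K : Type*} [Field K]

/-! Write the index as a function of the list of block sizes. Two reductions determine it: a last
block of size `sum l + c` may be replaced by one of size `c` (`index_shrink`), and equal outer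
blocks of size `N` around `l` contribute `N` plus the index of `l` (`index_split`). Since `N a^(k+2)
= (a - 1)(N + ⋯ + N a^(k+1)) + N`, the first turns `(N, …, N a^(k+2))` into `(N, N a, …, N a^(k+1),
N)`, and the second leaves `N` plus the index of `(N a, …, N a^(k+1))`. Hence an induction in steps
of two, and a geometric sum.

Both reductions rest on `finrank_stabilizer_eq`. The last block column is an abelian ideal `V`; when
`f` is in normal form on `V`, the stabilizer of `f` has the dimension of the stabilizer of its
restriction to a smaller algebra `B`. Choosing this restriction optimally bounds the index above.
For the lower bound, a generic form is conjugate to one in normal form, and stabilizers of generic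
forms on a line through `f` are no larger than that of `f`. -/

theorem eventually_det_eval_ne_zero {n : Type*} [Fintype n] [DecidableEq n]
    (P : Matrix n n (Polynomial K)) (t₀ : K)
    (h : (P.map (Polynomial.eval t₀)).det ≠ 0) :
    ∀ᶠ t : K in cofinite, (P.map (Polynomial.eval t)).det ≠ 0 := by
  have key : ∀ t : K, (P.map (Polynomial.eval t)).det = P.det.eval t := fun t =>
    (RingHom.map_det (Polynomial.evalRingHom t) P).symm
  have hp : P.det ≠ 0 := by
    rintro h0
    rw [key, h0, Polynomial.eval_zero] at h
    exact h rfl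
  simp only [eventually_cofinite, key, not_not]
  exact (Polynomial.finite_setOfPred_isRoot hp).subset fun t ht => ht

theorem eventually_det_add_smul_ne_zero {n : Type*} [Fintype n] [DecidableEq n]
    (A B : Matrix n n K) (t₀ : K) (h : (A + t₀ • B).det ≠ 0) :
    ∀ᶠ t : K in cofinite, (A + t • B).det ≠ 0 := by
  have key : ∀ t : K, (A.map Polynomial.C + (Polynomial.X : Polynomial K) •
      B.map Polynomial.C).map (Polynomial.eval t) = A + t • B := by
    intro t
    ext i j
    simp [mul_comm t]
  have := eventually_det_eval_ne_zero (A.map Polynomial.C + (Polynomial.X : Polynomial K) •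
      B.map Polynomial.C) t₀ (by rwa [key])
  simpa only [key] using this

/-- Upper semicontinuity of the kernel: on a complement `C` of `ker A`, injectivity of `A + t B` is
forced by the nonvanishing of a determinant polynomial in `t` that equals 1 at `t = 0`. -/
theorem eventually_finrank_ker_le {V W : Type*} [AddCommGroup V] [Module K V]
    [FiniteDimensional K V] [AddCommGroup W] [Module K W] (A B : V →ₗ[K] W) :
    ∀ᶠ t : K in cofinite,
      finrank K (LinearMap.ker (A + t • B)) ≤ finrank K (LinearMap.ker A) := by
  obtain ⟨C, hC⟩ := (LinearMap.ker A).exists_isCompl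
  have hinj : LinearMap.ker (A ∘ₗ C.subtype) = ⊥ := by
    rw [LinearMap.ker_comp, ← Submodule.disjoint_iff_comap_eq_bot]
    exact hC.symm.disjoint
  obtain ⟨L, hL⟩ := LinearMap.exists_leftInverse_of_injective _ hinj
  let b := finBasis K C
  have h1 : ∀ t : K, LinearMap.toMatrix b b (L ∘ₗ (A + t • B) ∘ₗ C.subtype) =
      1 + t • LinearMap.toMatrix b b (L ∘ₗ B ∘ₗ C.subtype) := by
    intro t
    rw [LinearMap.add_comp, LinearMap.comp_add, hL, map_add, LinearMap.toMatrix_id,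
      LinearMap.smul_comp, LinearMap.comp_smul, map_smul]
  filter_upwards [eventually_det_add_smul_ne_zero 1
    (LinearMap.toMatrix b b (L ∘ₗ B ∘ₗ C.subtype)) 0 (by simp)] with t ht
  rw [← h1, LinearMap.det_toMatrix] at ht
  have hd : Disjoint C (LinearMap.ker (A + t • B)) := by
    rw [Submodule.disjoint_def]
    intro x hx hx'
    have hbot := LinearMap.ker_eq_bot.1 ((LinearMap.isUnit_iff_ker_eq_bot _).1
      ((LinearMap.isUnit_iff_isUnit_det _).2 (isUnit_iff_ne_zero.2 ht)))
    have : (⟨x, hx⟩ : C) = 0 := hbot (by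
      rw [map_zero]
      simp only [LinearMap.comp_apply, Submodule.subtype_apply]
      rw [LinearMap.mem_ker.1 hx', map_zero])
    simpa using this
  have e1 := Submodule.finrank_add_eq_of_isCompl hC
  have e2 := Submodule.finrank_add_finrank_le_of_disjoint hd
  omega

variable {L : Type*} [LieRing L] [LieAlgebra K L]

/-- The linear map `x ↦ f ⁅x, ·⁆`, whose kernel is the stabilizer of `f`. -/
def kirillov (f : Dual K L) : L →ₗ[K] Dual K L :=
  LinearMap.mk₂ K (fun x y => f ⁅x, y⁆) (by simp) (by simp) (by simp) (by simp)

@[simp]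
theorem kirillov_apply (f : Dual K L) (x y : L) : kirillov f x y = f ⁅x, y⁆ := rfl

theorem mem_stabilizer {f : Dual K L} {x : L} : x ∈ stabilizer f ↔ ∀ y, f ⁅x, y⁆ = 0 := Iff.rfl

theorem stabilizer_toSubmodule (f : Dual K L) :
    (stabilizer f).toSubmodule = LinearMap.ker (kirillov f) := by
  ext x
  simp [mem_stabilizer, LinearMap.ext_iff]

theorem finrank_stabilizer (f : Dual K L) :
    finrank K (stabilizer f) = finrank K (LinearMap.ker (kirillov f)) :=
  congrArg (fun p : Submodule K L => finrank K p) (stabilizer_toSubmodule f)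

theorem index_le [FiniteDimensional K L] (f : Dual K L) : index K L ≤ finrank K (stabilizer f) :=
  ciInf_le (OrderBot.bddBelow _) f

theorem exists_index_eq [FiniteDimensional K L] : ∃ f : Dual K L, finrank K (stabilizer f) = index K L :=
  Nat.sInf_mem (Set.range_nonempty fun f : Dual K L => finrank K (stabilizer f))

theorem eventually_finrank_stabilizer_le [FiniteDimensional K L] (f f₀ : Dual K L) :
    ∀ᶠ t : K in cofinite,
      finrank K (stabilizer (f + t • (f₀ - f))) ≤ finrank K (stabilizer f) := by
  filter_upwards [eventually_finrank_ker_le (kirillov f) (kirillov (f₀ - f))] with t ht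
  have h : kirillov (f + t • (f₀ - f)) = kirillov f + t • kirillov (f₀ - f) := by
    ext x y
    simp
  rwa [finrank_stabilizer, finrank_stabilizer, h]

/-- The index is at least `d` as soon as the stabilizers of generic forms on a line through any
given form have dimension at least `d`. -/
theorem le_index_of_eventually [FiniteDimensional K L] [Infinite K] {d : ℕ} (h : ∀ f : Dual K L, ∃ f₀ : Dual K L,
    ∀ᶠ t : K in cofinite, d ≤ finrank K (stabilizer (f + t • (f₀ - f)))) : d ≤ index K L := by
  obtain ⟨f, hf⟩ := exists_index_eq (K := K) (L := L)
  obtain ⟨f₀, h₀⟩ := h f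
  obtain ⟨t, h1, h2⟩ := (h₀.and (eventually_finrank_stabilizer_le f f₀)).exists
  omega

variable {B : Type*} [LieRing B] [LieAlgebra K B]

theorem finrank_stabilizer_comp_equiv (e : B ≃ₗ⁅K⁆ L) (f : Dual K L) :
    finrank K (stabilizer (f ∘ₗ (e : B →ₗ[K] L))) = finrank K (stabilizer f) := by
  refine LinearEquiv.finrank_eq (LinearEquiv.ofSubmodules e.toLinearEquiv
    (stabilizer (f ∘ₗ (e : B →ₗ[K] L))).toSubmodule (stabilizer f).toSubmodule ?_)
  ext x
  rw [Submodule.mem_map_equiv]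
  change (∀ y, f (e ⁅e.symm x, y⁆) = 0) ↔ ∀ y, f ⁅x, y⁆ = 0
  refine ⟨fun h y => ?_, fun h y => ?_⟩
  · have := h (e.symm y)
    rwa [LieEquiv.map_lie, e.apply_symm_apply, e.apply_symm_apply] at this
  · have := h (e y)
    rwa [LieEquiv.map_lie, e.apply_symm_apply]

theorem index_congr [FiniteDimensional K L] [FiniteDimensional K B] (e : B ≃ₗ⁅K⁆ L) : index K B = index K L := by
  apply le_antisymm
  · obtain ⟨f, hf⟩ := exists_index_eq (K := K) (L := L)
    rw [← hf, ← finrank_stabilizer_comp_equiv e]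
    exact index_le _
  · obtain ⟨f, hf⟩ := exists_index_eq (K := K) (L := B)
    rw [← hf, ← finrank_stabilizer_comp_equiv e.symm]
    exact index_le _

/-- A dimension formula in the spirit of Raïs: the radical of the form `f ⁅·, ·⁆` is computed on
the stabilizer in `S` of the restriction of `f` to `V`. -/
theorem finrank_stabilizer_eq [FiniteDimensional K L] (f : Dual K L) (φ : B →ₗ⁅K⁆ L)
    (hφ : Function.Injective φ) (S V : Submodule K L) (hSV : IsCompl S V)
    (hV : ∀ v ∈ V, ∀ w ∈ V, f ⁅v, w⁆ = 0)
    (hVS : ∀ v ∈ V, (∀ s ∈ S, f ⁅v, s⁆ = 0) → v = 0)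
    (hr : ∀ x, (∃ y, φ y = x) ↔ x ∈ S ∧ ∀ v ∈ V, f ⁅x, v⁆ = 0) :
    finrank K (stabilizer f) = finrank K (stabilizer (f ∘ₗ (φ : B →ₗ[K] L))) := by
  have skew : ∀ x y, f ⁅x, y⁆ = - f ⁅y, x⁆ := fun x y => by rw [← lie_skew, map_neg]
  have hφS : ∀ b, φ b ∈ S := fun b => ((hr _).1 ⟨b, rfl⟩).1
  have hφV : ∀ b, ∀ v ∈ V, f ⁅φ b, v⁆ = 0 := fun b => ((hr _).1 ⟨b, rfl⟩).2
  have hsplit : ∀ x, ∃ s ∈ S, ∃ v ∈ V, s + v = x := fun x =>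
    Submodule.mem_sup.1 (hSV.sup_eq_top ▸ Submodule.mem_top (x := x))
  -- An element of the smaller stabilizer annihilates only `φ(B)` under `f`; a correction in `V`
  -- makes it annihilate all of `L`.
  have hex : ∀ b : stabilizer (f ∘ₗ (φ : B →ₗ[K] L)),
      ∃ v ∈ V, φ b.1 + v ∈ stabilizer f := by
    rintro ⟨b, hb⟩
    let Ω : V →ₗ[K] Dual K S := (LinearMap.lcomp K K S.subtype) ∘ₗ kirillov f ∘ₗ V.subtype
    have hmem : kirillov f (φ b) ∘ₗ S.subtype ∈ LinearMap.range Ω := by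
      -- A subspace of the dual of `S` is the annihilator of its coannihilator. Here the
      -- coannihilator is the part of `S` orthogonal to `V`, that is `φ(B)`, on which `f ⁅φ b, ·⁆`
      -- vanishes.
      rw [← Subspace.dualCoannihilator_dualAnnihilator_eq (W := LinearMap.range Ω),
        Submodule.mem_dualAnnihilator]
      intro s hs
      rw [Submodule.mem_dualCoannihilator] at hs
      obtain ⟨c, hc⟩ := (hr s.1).2 ⟨s.2, fun v hv => by
        have := hs (Ω ⟨v, hv⟩) (LinearMap.mem_range_self _ _)
        rw [skew, neg_eq_zero]
        exact this⟩
      have := hb c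
      simp only [LinearMap.comp_apply, Submodule.subtype_apply, kirillov_apply, ← hc]
      simpa using this
    obtain ⟨v, hv⟩ := hmem
    refine ⟨-v.1, V.neg_mem v.2, fun y => ?_⟩
    obtain ⟨s, hs, w, hw, rfl⟩ := hsplit y
    have h1 : f ⁅v.1, s⁆ = f ⁅φ b, s⁆ := LinearMap.congr_fun hv ⟨s, hs⟩
    rw [add_lie, neg_lie, lie_add, lie_add, map_add, map_add, map_neg, map_add, h1,
      hφV b w hw, hV _ v.2 w hw]
    ring
  choose g hgV hg using hex
  have huniq : ∀ v ∈ V, v ∈ stabilizer f → v = 0 := fun v hv h => hVS v hv fun s _ => h s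
  -- Uniqueness of the correction makes the arbitrary choice `g` linear.
  have hinjS : ∀ x ∈ V, ∀ y ∈ V, ∀ z, z + x ∈ stabilizer f → z + y ∈ stabilizer f → x = y := by
    intro x hx y hy z h1 h2
    refine sub_eq_zero.1 (huniq _ (V.sub_mem hx hy) ?_)
    simpa using (stabilizer f).sub_mem h1 h2
  let G : stabilizer (f ∘ₗ (φ : B →ₗ[K] L)) →ₗ[K] stabilizer f :=
    { toFun := fun b => ⟨φ b.1 + g b, hg b⟩
      map_add' := fun b c => by
        ext
        have := hinjS (g (b + c)) (hgV _) (g b + g c) (V.add_mem (hgV _) (hgV _))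
          (φ (b + c : stabilizer (f ∘ₗ (φ : B →ₗ[K] L))).1) (hg _) (by
            have h := (stabilizer f).add_mem (hg b) (hg c)
            convert h using 1
            change φ (b.1 + c.1) + _ = _
            rw [map_add]
            abel)
        change φ (b.1 + c.1) + _ = φ b.1 + g b + (φ c.1 + g c)
        rw [this, map_add]
        abel
      map_smul' := fun t b => by
        ext
        have := hinjS (g (t • b)) (hgV _) (t • g b) (V.smul_mem _ (hgV _))
          (φ (t • b : stabilizer (f ∘ₗ (φ : B →ₗ[K] L))).1) (hg _) (by
            have h := (stabilizer f).smul_mem t (hg b)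
            convert h using 1
            simp)
        simp [this] }
  symm
  refine LinearEquiv.finrank_eq (LinearEquiv.ofBijective G ⟨?_, ?_⟩)
  · rw [← LinearMap.ker_eq_bot, LinearMap.ker_eq_bot']
    intro b hb
    have hb0 : φ b.1 + g b = 0 := congrArg Subtype.val hb
    have hST : φ b.1 = 0 := by
      refine Submodule.disjoint_def.1 hSV.disjoint _ (hφS _) ?_
      rw [eq_neg_of_add_eq_zero_left hb0]
      exact V.neg_mem (hgV b)
    have : b.1 = 0 := hφ (by rw [hST, map_zero])
    exact Subtype.ext this
  · rintro ⟨x, hx⟩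
    obtain ⟨s, hs, v, hv, rfl⟩ := hsplit x
    obtain ⟨b, rfl⟩ := (hr s).2 ⟨hs, fun w hw => by
      simpa [hV v hv w hw] using hx w⟩
    have hb : b ∈ stabilizer (f ∘ₗ (φ : B →ₗ[K] L)) := fun y => by
      have h1 := hx (φ y)
      rw [add_lie, map_add, skew v, hφV y v hv, neg_zero, add_zero] at h1
      simpa using h1
    refine ⟨⟨b, hb⟩, Subtype.ext ?_⟩
    change φ b + g ⟨b, hb⟩ = φ b + v
    rw [hinjS _ (hgV _) v hv _ (hg ⟨b, hb⟩) hx]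
end General

/-! ### Block triangular algebras, trace forms and the last block column. -/

section BlockTriangular

variable {K : Type*} [Field K]

variable {ι ι' α α' : Type*} [LinearOrder α] [LinearOrder α']

theorem blockTriangular_fromBlocks_iff {b₁ : ι → α} {b₂ : ι' → α} (h : ∀ i j, b₁ i < b₂ j)
    {A : Matrix ι ι K} {B : Matrix ι ι' K} {C : Matrix ι' ι K} {D : Matrix ι' ι' K} :
    (fromBlocks A B C D).BlockTriangular (Sum.elim b₁ b₂) ↔
      A.BlockTriangular b₁ ∧ C = 0 ∧ D.BlockTriangular b₂ := by
  constructor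
  · intro H
    refine ⟨fun i j hij => H (i := Sum.inl i) (j := Sum.inl j) hij, ?_,
      fun i j hij => H (i := Sum.inr i) (j := Sum.inr j) hij⟩
    ext i j
    exact H (i := Sum.inr i) (j := Sum.inl j) (h j i)
  · rintro ⟨hA, rfl, hD⟩ (i | i) (j | j) hij
    · exact hA hij
    · exact absurd hij (h i j).asymm
    · rfl
    · exact hD hij

theorem blockTriangular_const (m : α) (D : Matrix ι ι K) :
    D.BlockTriangular (fun _ => m) := fun _ _ h => absurd h (lt_irrefl _)

/-- The Lie algebra of block triangular matrices attached to a labelling `b` of the indices. -/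
def blockAlgebra (K : Type*) [Field K] {ι α : Type*} [Fintype ι] [DecidableEq ι] [LinearOrder α]
    (b : ι → α) : LieSubalgebra K (Matrix ι ι K) where
  carrier := {M | M.BlockTriangular b}
  zero_mem' := blockTriangular_zero
  add_mem' := fun hM hN => BlockTriangular.add hM hN
  smul_mem' := by
    intro t M hM i j hij
    rw [Matrix.smul_apply, hM hij, smul_zero]
  lie_mem' := by
    intro M N hM hN
    rw [Ring.lie_def]
    exact (BlockTriangular.mul hM hN).sub (BlockTriangular.mul hN hM)

variable [Fintype ι] [DecidableEq ι] [Fintype ι'] [DecidableEq ι']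

@[simp]
theorem mem_blockAlgebra {b : ι → α} {M : Matrix ι ι K} :
    M ∈ blockAlgebra K b ↔ M.BlockTriangular b := Iff.rfl

/-- Relabelling the indices. -/
def blockAlgebraReindex (K : Type*) [Field K] (b : ι → α) (b' : ι' → α') (e : ι ≃ ι')
    (h : ∀ i j, b i < b j ↔ b' (e i) < b' (e j)) :
    blockAlgebra K b ≃ₗ⁅K⁆ blockAlgebra K b' where
  toFun x := ⟨x.1.submatrix e.symm e.symm, fun i j hij => x.2 (by
    rw [h, e.apply_symm_apply, e.apply_symm_apply]
    exact hij)⟩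
  invFun x := ⟨x.1.submatrix e e, fun i j hij => x.2 ((h _ _).1 hij)⟩
  left_inv x := by ext; simp
  right_inv x := by ext; simp
  map_add' x y := rfl
  map_smul' t x := rfl
  map_lie' := by
    intro x y
    ext1
    simp [Ring.lie_def, Matrix.submatrix_mul_equiv, Matrix.submatrix_sub]

theorem index_blockAlgebra_congr {b : ι → α} {b' : ι' → α'} (e : ι ≃ ι')
    (h : ∀ i j, b i < b j ↔ b' (e i) < b' (e j)) :
    index K (blockAlgebra K b) = index K (blockAlgebra K b') :=
  index_congr (blockAlgebraReindex K b b' e h)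

/-- The linear form `x ↦ tr (Φ x)`. -/
def traceDual (b : ι → α) (Φ : Matrix ι ι K) : Dual K (blockAlgebra K b) :=
  traceLinearMap ι K K ∘ₗ LinearMap.mulLeft K Φ ∘ₗ (blockAlgebra K b).toSubmodule.subtype

@[simp]
theorem traceDual_apply (b : ι → α) (Φ : Matrix ι ι K) (x : blockAlgebra K b) :
    traceDual b Φ x = trace (Φ * x.1) := rfl

theorem traceDual_add_smul_sub (b : ι → α) (Φ Ψ : Matrix ι ι K) (t : K) :
    traceDual b Φ + t • (traceDual b Ψ - traceDual b Φ) = traceDual b (Φ + t • (Ψ - Φ)) := by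
  ext x
  simp [add_mul, sub_mul]

theorem exists_trace_eq (p : Submodule K (Matrix ι ι K)) (f : Dual K p) :
    ∃ Φ : Matrix ι ι K, ∀ x : p, f x = trace (Φ * x.1) := by
  obtain ⟨g, hg⟩ := LinearMap.exists_extend f
  refine ⟨Matrix.of fun i j => g (Matrix.single j i 1), fun x => ?_⟩
  have h : f x = g x.1 := (LinearMap.congr_fun hg x).symm
  rw [h]
  have key : g = traceLinearMap ι K K ∘ₗ
      LinearMap.mulLeft K (Matrix.of fun i j => g (Matrix.single j i 1)) := by
    refine Matrix.ext_linearMap K fun i j => ?_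
    ext
    simp [trace_mul_single]
  exact LinearMap.congr_fun key x.1

theorem traceDual_surjective (b : ι → α) :
    Function.Surjective (traceDual b : Matrix ι ι K → Dual K (blockAlgebra K b)) := by
  intro f
  obtain ⟨Φ, hΦ⟩ := exists_trace_eq (blockAlgebra K b).toSubmodule f
  exact ⟨Φ, LinearMap.ext fun x => (hΦ x).symm⟩

/-- Conjugation by a block triangular matrix `u` with block triangular inverse `v`. -/
def blockAlgebraConj (b : ι → α) (u v : Matrix ι ι K) (hu : u.BlockTriangular b)
    (hv : v.BlockTriangular b) (huv : u * v = 1) :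
    blockAlgebra K b ≃ₗ⁅K⁆ blockAlgebra K b where
  toFun x := ⟨u * x.1 * v, (hu.mul x.2).mul hv⟩
  invFun x := ⟨v * x.1 * u, (hv.mul x.2).mul hu⟩
  left_inv x := by
    ext1
    have hvu := mul_eq_one_comm.1 huv
    simp only [← mul_assoc, hvu, one_mul]
    simp only [mul_assoc, hvu, mul_one]
  right_inv x := by
    ext1
    simp only [← mul_assoc, huv, one_mul]
    simp only [mul_assoc, huv, mul_one]
  map_add' x y := by ext1; simp [mul_add, add_mul]
  map_smul' t x := by ext1; simp
  map_lie' := by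
    intro x y
    ext1
    have h : ∀ p q : Matrix ι ι K, u * (p * q) * v = (u * p * v) * (u * q * v) := by
      intro p q
      have hvu := mul_eq_one_comm.1 huv
      rw [mul_assoc (u * p), ← mul_assoc v, ← mul_assoc v, hvu, one_mul]
      simp only [mul_assoc]
    simp only [LieSubalgebra.coe_bracket, Ring.lie_def, mul_sub, sub_mul, h]

/-- By cyclicity of the trace, the automorphism `x ↦ u x v` carries `Φ` to `v Φ u`. This is what
brings a generic `Φ` to normal form. -/
theorem finrank_stabilizer_traceDual_conj (b : ι → α) (u v : Matrix ι ι K)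
    (hu : u.BlockTriangular b) (hv : v.BlockTriangular b) (huv : u * v = 1)
    (Φ : Matrix ι ι K) :
    finrank K (stabilizer (traceDual b (v * Φ * u))) =
      finrank K (stabilizer (traceDual b Φ)) := by
  rw [← finrank_stabilizer_comp_equiv (blockAlgebraConj b u v hu hv huv) (traceDual b Φ)]
  have : traceDual b (v * Φ * u) = traceDual b Φ ∘ₗ
      ((blockAlgebraConj b u v hu hv huv : blockAlgebra K b ≃ₗ⁅K⁆ blockAlgebra K b) :
        blockAlgebra K b →ₗ[K] blockAlgebra K b) := ?_
  · rw [this]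
  ext x
  change trace (v * Φ * u * x.1) = trace (Φ * (u * x.1 * v))
  rw [← mul_assoc Φ, trace_mul_comm _ v]
  simp only [mul_assoc]

theorem exists_blocks {b₁ : ι → α} {m : α} (h : ∀ i, b₁ i < m)
    (x : blockAlgebra K (Sum.elim b₁ fun _ : ι' => m)) :
    ∃ (P : Matrix ι ι K) (U : Matrix ι ι' K) (G : Matrix ι' ι' K),
      P.BlockTriangular b₁ ∧ x.1 = fromBlocks P U 0 G := by
  have hx := x.2
  rw [mem_blockAlgebra, ← fromBlocks_toBlocks x.1,
    blockTriangular_fromBlocks_iff (fun i _ => h i)] at hx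
  refine ⟨x.1.toBlocks₁₁, x.1.toBlocks₁₂, x.1.toBlocks₂₂, hx.1, ?_⟩
  rw [← hx.2.1, fromBlocks_toBlocks]

theorem trace_mul_fromBlocks (Φ : Matrix (ι ⊕ ι') (ι ⊕ ι') K) (U : Matrix ι ι' K) :
    trace (Φ * fromBlocks 0 U 0 0) = trace (Φ.toBlocks₂₁ * U) := by
  conv_lhs => rw [← fromBlocks_toBlocks Φ]
  rw [fromBlocks_multiply]
  simp [trace, Fintype.sum_sum_type]

/-- Here `V` is the last block column and `S` its block diagonal complement. Only `Φ₂₁` pairs with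
`V`: for `x = (P, G)` in `S`, `f ⁅x, U⁆ = tr ((Φ₂₁ P - G Φ₂₁) U)`, so orthogonality to `V` is the
equation in `hr`, while `hnd` is nondegeneracy of the pairing on the side of `V`. -/
theorem finrank_stabilizer_traceDual_eq {B : Type*} [LieRing B] [LieAlgebra K B]
    {b₁ : ι → α} {m : α} (h : ∀ i, b₁ i < m) (Φ : Matrix (ι ⊕ ι') (ι ⊕ ι') K)
    (hnd : ∀ U : Matrix ι ι' K, Φ.toBlocks₂₁ * U = 0 →
      (∀ P : Matrix ι ι K, P.BlockTriangular b₁ → trace (Φ.toBlocks₂₁ * (P * U)) = 0) → U = 0)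
    (φ : B →ₗ⁅K⁆ blockAlgebra K (Sum.elim b₁ fun _ : ι' => m)) (hφ : Function.Injective φ)
    (hr : ∀ x, (∃ y, φ y = x) ↔ x.1.toBlocks₁₂ = 0 ∧
      Φ.toBlocks₂₁ * x.1.toBlocks₁₁ = x.1.toBlocks₂₂ * Φ.toBlocks₂₁) :
    finrank K (stabilizer (traceDual (Sum.elim b₁ fun _ => m) Φ)) =
      finrank K (stabilizer (traceDual (Sum.elim b₁ fun _ => m) Φ ∘ₗ
        (φ : B →ₗ[K] blockAlgebra K (Sum.elim b₁ fun _ => m)))) := by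
  let b : ι ⊕ ι' → α := Sum.elim b₁ fun _ : ι' => m
  let S : Submodule K (blockAlgebra K b) :=
    { carrier := {x | x.1.toBlocks₁₂ = 0}
      zero_mem' := rfl
      add_mem' := by
        intro x y (hx : x.1.toBlocks₁₂ = 0) (hy : y.1.toBlocks₁₂ = 0)
        change x.1.toBlocks₁₂ + y.1.toBlocks₁₂ = 0
        rw [hx, hy, add_zero]
      smul_mem' := by
        intro t x (hx : x.1.toBlocks₁₂ = 0)
        change t • x.1.toBlocks₁₂ = 0
        rw [hx, smul_zero] }
  let T : Matrix ι ι' K →ₗ[K] blockAlgebra K b :=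
    { toFun := fun U => ⟨fromBlocks 0 U 0 0, (blockTriangular_fromBlocks_iff (fun i _ => h i)).2
        ⟨blockTriangular_zero, rfl, blockTriangular_zero⟩⟩
      map_add' := fun U V => by ext1; simp [fromBlocks_add]
      map_smul' := fun t U => by ext1; simp [fromBlocks_smul] }
  have hlie : ∀ (x : blockAlgebra K b) (P : Matrix ι ι K) (V : Matrix ι ι' K)
      (G : Matrix ι' ι' K) (U : Matrix ι ι' K),
      x.1 = fromBlocks P V 0 G → traceDual b Φ ⁅x, T U⁆ =
        trace (Φ.toBlocks₂₁ * (P * U - U * G)) := by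
    intro x P V G U hx
    rw [traceDual_apply, LieSubalgebra.coe_bracket, hx, ← trace_mul_fromBlocks Φ]
    simp [T, Ring.lie_def, fromBlocks_multiply, sub_eq_add_neg, fromBlocks_neg, fromBlocks_add]
  refine finrank_stabilizer_eq _ φ hφ S (LinearMap.range T) ?_ ?_ ?_ ?_
  · constructor
    · rw [Submodule.disjoint_def]
      rintro _ hx ⟨U, rfl⟩
      have hU : U = 0 := hx
      rw [hU, map_zero]
    · rw [codisjoint_iff, eq_top_iff]
      intro x _
      obtain ⟨P, U, G, hP, hx⟩ := exists_blocks h x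
      have : x = (x - T U) + T U := by abel
      rw [this]
      refine Submodule.add_mem_sup ?_ ⟨U, rfl⟩
      change x.1.toBlocks₁₂ - U = 0
      rw [hx, toBlocks_fromBlocks₁₂, sub_self]
  · rintro _ ⟨U, rfl⟩ _ ⟨V, rfl⟩
    rw [hlie _ 0 U 0 V rfl]
    simp
  · rintro _ ⟨U, rfl⟩ hU
    have key : ∀ (P : Matrix ι ι K) (G : Matrix ι' ι' K), P.BlockTriangular b₁ →
        trace (Φ.toBlocks₂₁ * (P * U - U * G)) = 0 := by
      intro P G hP
      have := hU ⟨fromBlocks P 0 0 G, (blockTriangular_fromBlocks_iff (fun i _ => h i)).2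
        ⟨hP, rfl, blockTriangular_const m G⟩⟩ (toBlocks_fromBlocks₁₂ _ _ _ _)
      rw [← lie_skew, map_neg, neg_eq_zero, hlie _ P 0 G U rfl] at this
      exact this
    rw [hnd U ?_ ?_, map_zero]
    · rw [ext_iff_trace_mul_right]
      intro G
      have := key 0 G blockTriangular_zero
      simpa [Matrix.mul_assoc] using this
    · intro P hP
      simpa using key P 0 hP
  · intro x
    rw [hr]
    refine and_congr_right fun hx0 => ?_
    obtain ⟨P, U, G, hP, hx⟩ := exists_blocks h x
    rw [hx, toBlocks_fromBlocks₁₁, toBlocks_fromBlocks₂₂, ext_iff_trace_mul_right]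
    have : ∀ V, traceDual b Φ ⁅x, T V⁆ = trace (Φ.toBlocks₂₁ * P * V) -
        trace (G * Φ.toBlocks₂₁ * V) := by
      intro V
      rw [hlie x P U G V hx, Matrix.mul_sub, trace_sub, Matrix.mul_assoc,
        ← Matrix.mul_assoc _ V G, trace_mul_comm _ G, Matrix.mul_assoc G]
    constructor
    · rintro H _ ⟨V, rfl⟩
      rw [this, H V, sub_self]
    · intro H V
      exact sub_eq_zero.1 ((this V).symm.trans (H _ ⟨V, rfl⟩))

end BlockTriangular

/-! ### Shrinking the last block. -/

section Reduction

variable {K : Type*} [Field K] {ι κ : Type*} [Fintype ι] [DecidableEq ι] [Fintype κ]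
  [DecidableEq κ]

/-- The embedding of the stabilizer of the form `U ↦ tr (U₁)` for the last block column. -/
def shrinkHom (K : Type*) [Field K] (κ : Type*) [Fintype κ] [DecidableEq κ] {b : ι → ℕ} {m : ℕ}
    (h : ∀ i, b i < m) :
    blockAlgebra K (Sum.elim b fun _ : κ => m) →ₗ⁅K⁆
      blockAlgebra K (Sum.elim b fun _ : ι ⊕ κ => m) where
  toFun x := ⟨fromBlocks x.1.toBlocks₁₁ 0 0 x.1,
    (blockTriangular_fromBlocks_iff (fun i _ => h i)).2
      ⟨fun _ _ hij => x.2 hij, rfl, blockTriangular_const m _⟩⟩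
  map_add' x y := by
    ext1
    change _ = fromBlocks _ _ _ _ + fromBlocks _ _ _ _
    rw [fromBlocks_add, add_zero, add_zero]
    rfl
  map_smul' t x := by
    ext1
    change _ = t • fromBlocks _ _ _ _
    rw [fromBlocks_smul, smul_zero, smul_zero]
    rfl
  map_lie' := by
    intro x y
    ext1
    obtain ⟨P, U, G, -, hx⟩ := exists_blocks h x
    obtain ⟨P', U', G', -, hy⟩ := exists_blocks h y
    simp [Ring.lie_def, hx, hy, fromBlocks_multiply, sub_eq_add_neg, fromBlocks_neg,
      fromBlocks_add]

/-- With `Φ₂₁` the column `(1; 0)`, the equation `Φ₂₁ P = G Φ₂₁` says that `G` has first block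
column `(P; 0)`. So `G` ranges over the smaller parabolic and determines `P`. -/
theorem finrank_stabilizer_shrink {b : ι → ℕ} {m : ℕ} (h : ∀ i, b i < m)
    (Φ : Matrix (ι ⊕ (ι ⊕ κ)) (ι ⊕ (ι ⊕ κ)) K) (hΦ : Φ.toBlocks₂₁ = fromRows 1 0) :
    finrank K (stabilizer (traceDual (Sum.elim b fun _ => m) Φ)) =
      finrank K (stabilizer (traceDual (Sum.elim b fun _ => m) Φ ∘ₗ
        (shrinkHom K κ h : blockAlgebra K (Sum.elim b fun _ : κ => m) →ₗ[K]
          blockAlgebra K (Sum.elim b fun _ : ι ⊕ κ => m)))) := by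
  refine finrank_stabilizer_traceDual_eq h Φ ?_ (shrinkHom K κ h) ?_ ?_
  · intro U hU _
    rw [hΦ, fromRows_mul, Matrix.one_mul] at hU
    ext i j
    exact congrFun (congrFun hU (Sum.inl i)) j
  · intro x y hxy
    ext1
    have := congrArg (fun z => z.1.toBlocks₂₂) hxy
    exact this
  · intro x
    obtain ⟨P, U, G, hP, hx⟩ := exists_blocks h x
    rw [hx, toBlocks_fromBlocks₁₁, toBlocks_fromBlocks₂₂, toBlocks_fromBlocks₁₂, hΦ]
    constructor
    · rintro ⟨y, rfl⟩
      have hx : fromBlocks y.1.toBlocks₁₁ 0 0 y.1 = fromBlocks P U 0 G := hx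
      obtain ⟨Q, V, H, -, hy⟩ := exists_blocks h y
      rw [fromBlocks_inj] at hx
      refine ⟨hx.2.1.symm, ?_⟩
      rw [← hx.1, ← hx.2.2.2, hy]
      simp [fromBlocks_mul_fromRows, fromRows_mul]
    · rintro ⟨rfl, hG⟩
      rw [← fromBlocks_toBlocks G, fromBlocks_mul_fromRows, fromRows_mul] at hG
      simp only [Matrix.one_mul, Matrix.zero_mul, Matrix.mul_one, Matrix.mul_zero, add_zero] at hG
      obtain ⟨h1, h2⟩ := fromRows_inj hG
      refine ⟨⟨G, ?_⟩, ?_⟩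
      · rw [mem_blockAlgebra, ← fromBlocks_toBlocks G,
          blockTriangular_fromBlocks_iff (fun i _ => h i)]
        exact ⟨h1 ▸ hP, h2.symm, blockTriangular_const m _⟩
      · ext1
        subst h1
        exact hx.symm

/-- Removing from the last block the total size of the other blocks preserves the index. -/
theorem index_shrink [Infinite K] {b : ι → ℕ} {m : ℕ} (h : ∀ i, b i < m) :
    index K (blockAlgebra K (Sum.elim b fun _ : ι ⊕ κ => m)) =
      index K (blockAlgebra K (Sum.elim b fun _ : κ => m)) := by
  apply le_antisymm
  · obtain ⟨f, hf⟩ := exists_index_eq (K := K)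
      (L := blockAlgebra K (Sum.elim b fun _ : κ => m))
    obtain ⟨Γ, rfl⟩ := traceDual_surjective _ f
    rw [← hf]
    refine (index_le (traceDual _ (fromBlocks 0 0 (fromRows 1 0) Γ))).trans (le_of_eq ?_)
    rw [finrank_stabilizer_shrink h _ (toBlocks_fromBlocks₂₁ _ _ _ _)]
    have : traceDual (Sum.elim b fun _ : ι ⊕ κ => m) (fromBlocks 0 0 (fromRows 1 0) Γ) ∘ₗ
        (shrinkHom K κ h : blockAlgebra K (Sum.elim b fun _ : κ => m) →ₗ[K]
          blockAlgebra K (Sum.elim b fun _ : ι ⊕ κ => m)) = traceDual _ Γ := by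
      ext x
      change trace (fromBlocks 0 0 (fromRows 1 0) Γ * fromBlocks x.1.toBlocks₁₁ 0 0 x.1) =
        trace (Γ * x.1)
      simp [fromBlocks_multiply, trace, Fintype.sum_sum_type]
    rw [this]
  · refine le_index_of_eventually fun f => ?_
    obtain ⟨Φ, rfl⟩ := traceDual_surjective _ f
    refine ⟨traceDual _ (fromBlocks 0 0 (fromRows 1 0) 0), ?_⟩
    -- At `t = 1` the square block is the identity, so it is invertible for all but finitely many
    -- `t`.
    filter_upwards [eventually_det_add_smul_ne_zero Φ.toBlocks₂₁.toRows₁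
      (1 - Φ.toBlocks₂₁.toRows₁) 1 (by simp)] with t ht
    rw [traceDual_add_smul_sub]
    set Ψ := Φ + t • (fromBlocks 0 0 (fromRows 1 0) 0 - Φ) with hΨ
    have hΨ₁ : Ψ.toBlocks₂₁.toRows₁ =
        Φ.toBlocks₂₁.toRows₁ + t • (1 - Φ.toBlocks₂₁.toRows₁) := by
      ext i j
      rfl
    rw [← hΨ₁] at ht
    clear_value Ψ
    clear hΨ hΨ₁
    set F := Ψ.toBlocks₂₁.toRows₁
    set E := Ψ.toBlocks₂₁.toRows₂
    have hF : F * F⁻¹ = 1 := mul_nonsing_inv _ (isUnit_iff_ne_zero.2 ht)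
    have hF' : F⁻¹ * F = 1 := nonsing_inv_mul _ (isUnit_iff_ne_zero.2 ht)
    -- Row operations inside the last diagonal block bring `(F; E)` to `(1; 0)`.
    rw [← finrank_stabilizer_traceDual_conj (Sum.elim b fun _ : ι ⊕ κ => m)
      (fromBlocks 1 0 0 (fromBlocks F 0 E 1)) (fromBlocks 1 0 0 (fromBlocks F⁻¹ 0 (-(E * F⁻¹)) 1))
      ((blockTriangular_fromBlocks_iff (fun i _ => h i)).2
        ⟨blockTriangular_one, rfl, blockTriangular_const m _⟩)
      ((blockTriangular_fromBlocks_iff (fun i _ => h i)).2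
        ⟨blockTriangular_one, rfl, blockTriangular_const m _⟩)
      (by simp [fromBlocks_multiply, hF]),
      finrank_stabilizer_shrink h]
    · exact index_le _
    · have hΨF : Ψ.toBlocks₂₁ = fromRows F E := (fromRows_toRows _).symm
      conv_lhs => rw [← fromBlocks_toBlocks Ψ]
      rw [fromBlocks_multiply, fromBlocks_multiply, toBlocks_fromBlocks₂₁, hΨF]
      simp [fromBlocks_mul_fromRows, hF', Matrix.mul_assoc]

end Reduction

/-! ### Additivity of the index on products. -/

section Prod

variable {K : Type*} [Field K] {L₁ L₂ : Type*} [LieRing L₁] [LieAlgebra K L₁] [LieRing L₂]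
  [LieAlgebra K L₂] [FiniteDimensional K L₁] [FiniteDimensional K L₂]

theorem finrank_stabilizer_coprod (f₁ : Dual K L₁) (f₂ : Dual K L₂) :
    finrank K (stabilizer (f₁.coprod f₂)) =
      finrank K (stabilizer f₁) + finrank K (stabilizer f₂) := by
  have h : ∀ x : L₁ × L₂, x ∈ stabilizer (f₁.coprod f₂) ↔
      x.1 ∈ stabilizer f₁ ∧ x.2 ∈ stabilizer f₂ := by
    intro x
    simp only [mem_stabilizer, LinearMap.coprod_apply, LieAlgebra.Prod.bracket_apply]
    exact ⟨fun H => ⟨fun y => by simpa using H (y, 0), fun y => by simpa using H (0, y)⟩,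
      fun H y => by rw [H.1, H.2, add_zero]⟩
  rw [← finrank_prod]
  exact LinearEquiv.finrank_eq
    { toFun := fun x => (⟨x.1.1, ((h _).1 x.2).1⟩, ⟨x.1.2, ((h _).1 x.2).2⟩)
      invFun := fun x => ⟨(x.1.1, x.2.1), (h _).2 ⟨x.1.2, x.2.2⟩⟩
      left_inv := fun x => rfl
      right_inv := fun x => rfl
      map_add' := fun x y => rfl
      map_smul' := fun t x => rfl }

theorem index_prod : index K (L₁ × L₂) = index K L₁ + index K L₂ := by
  apply le_antisymm
  · obtain ⟨f₁, h₁⟩ := exists_index_eq (K := K) (L := L₁)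
    obtain ⟨f₂, h₂⟩ := exists_index_eq (K := K) (L := L₂)
    rw [← h₁, ← h₂, ← finrank_stabilizer_coprod]
    exact index_le _
  · obtain ⟨f, hf⟩ := exists_index_eq (K := K) (L := L₁ × L₂)
    rw [← hf, ← LinearMap.coprod_comp_inl_inr f, finrank_stabilizer_coprod]
    exact add_le_add (index_le _) (index_le _)

end Prod

/-! ### Splitting off equal outer blocks. -/

section Reduction

variable {K : Type*} [Field K] {ι κ : Type*} [Fintype ι] [DecidableEq ι] [Fintype κ]
  [DecidableEq κ]

/-- The embedding of the stabilizer of the form `U ↦ tr (U₁)` for the last block column, when the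
first and the last block have the same size. -/
def splitHom (K : Type*) [Field K] (κ : Type*) [Fintype κ] [DecidableEq κ] {b : ι → ℕ} {p m : ℕ}
    (hp : ∀ i, p < b i) (h : ∀ i, Sum.elim (fun _ : κ => p) b i < m) :
    blockAlgebra K (fun _ : κ => p) × blockAlgebra K b →ₗ⁅K⁆
      blockAlgebra K (Sum.elim (Sum.elim (fun _ : κ => p) b) fun _ : κ => m) where
  toFun x := ⟨fromBlocks (fromBlocks x.1.1 0 0 x.2.1) 0 0 x.1.1,
    (blockTriangular_fromBlocks_iff (fun i _ => h i)).2
      ⟨(blockTriangular_fromBlocks_iff (fun _ j => hp j)).2 ⟨x.1.2, rfl, x.2.2⟩, rfl,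
        blockTriangular_const m _⟩⟩
  map_add' x y := by
    ext1
    simp [fromBlocks_add]
  map_smul' t x := by
    ext1
    simp [fromBlocks_smul]
  map_lie' := by
    intro x y
    ext1
    simp [Ring.lie_def, fromBlocks_multiply, sub_eq_add_neg, fromBlocks_neg, fromBlocks_add]

/-- With `Φ₂₁` the row `(1 0)`, the equation `Φ₂₁ P = G Φ₂₁` reads `P₁₁ = G`, `P₁₂ = 0`, and `P₂₂`
stays free. -/
theorem finrank_stabilizer_split {b : ι → ℕ} {p m : ℕ}
    (hp : ∀ i, p < b i) (h : ∀ i, Sum.elim (fun _ : κ => p) b i < m)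
    (Φ : Matrix ((κ ⊕ ι) ⊕ κ) ((κ ⊕ ι) ⊕ κ) K) (hΦ : Φ.toBlocks₂₁ = fromCols 1 0) :
    finrank K (stabilizer (traceDual (Sum.elim (Sum.elim (fun _ => p) b) fun _ => m) Φ)) =
      finrank K (stabilizer (traceDual (Sum.elim (Sum.elim (fun _ => p) b) fun _ => m) Φ ∘ₗ
        (splitHom K κ hp h : blockAlgebra K (fun _ : κ => p) × blockAlgebra K b →ₗ[K]
          blockAlgebra K (Sum.elim (Sum.elim (fun _ : κ => p) b) fun _ : κ => m)))) := by
  refine finrank_stabilizer_traceDual_eq h Φ ?_ (splitHom K κ hp h) ?_ ?_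
  · intro U hU hP
    rw [hΦ] at hU hP
    rw [← fromRows_toRows U, fromCols_mul_fromRows, Matrix.one_mul, Matrix.zero_mul,
      add_zero] at hU
    have h2 : U.toRows₂ = 0 := by
      rw [ext_iff_trace_mul_left]
      intro Q
      -- `Φ₂₁ U = 0` only kills the top rows of `U`; the strip `Q` to the right of the first block
      -- lifts the remaining rows into the top, where `Φ₂₁` sees them.
      have := hP (fromBlocks 0 Q 0 0) ((blockTriangular_fromBlocks_iff (fun _ j => hp j)).2
        ⟨blockTriangular_zero, rfl, blockTriangular_zero⟩)
      rw [← fromRows_toRows U, fromBlocks_mul_fromRows, fromCols_mul_fromRows] at this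
      simpa using this
    rw [← fromRows_toRows U, hU, h2, fromRows_zero]
  · intro x y hxy
    have h1 := congrArg (fun z => z.1.toBlocks₂₂) hxy
    have h2 := congrArg (fun z => z.1.toBlocks₁₁.toBlocks₂₂) hxy
    exact Prod.ext (Subtype.ext h1) (Subtype.ext h2)
  · intro x
    obtain ⟨P, U, G, hP, hx⟩ := exists_blocks h x
    rw [hx, toBlocks_fromBlocks₁₁, toBlocks_fromBlocks₂₂, toBlocks_fromBlocks₁₂, hΦ]
    constructor
    · rintro ⟨y, rfl⟩
      have hx : fromBlocks (fromBlocks y.1.1 0 0 y.2.1) 0 0 y.1.1 = fromBlocks P U 0 G := hx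
      rw [fromBlocks_inj] at hx
      refine ⟨hx.2.1.symm, ?_⟩
      rw [← hx.1, ← hx.2.2.2]
      simp [fromCols_mul_fromBlocks, mul_fromCols]
    · rintro ⟨rfl, hG⟩
      rw [← fromBlocks_toBlocks P, blockTriangular_fromBlocks_iff (fun _ j => hp j)] at hP
      rw [← fromBlocks_toBlocks P, fromCols_mul_fromBlocks, mul_fromCols] at hG
      simp only [Matrix.one_mul, Matrix.zero_mul, Matrix.mul_one, Matrix.mul_zero, add_zero] at hG
      obtain ⟨h1, h2⟩ := fromCols_inj hG
      refine ⟨(⟨G, blockTriangular_const p _⟩, ⟨P.toBlocks₂₂, hP.2.2⟩), ?_⟩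
      ext1
      rw [hx]
      change fromBlocks (fromBlocks G 0 0 P.toBlocks₂₂) 0 0 G = _
      conv_rhs => rw [← fromBlocks_toBlocks P, h1, h2, hP.2.1]

/-- When the first and the last block have the same size, the index splits. -/
theorem index_split [Infinite K] {b : ι → ℕ} {p m : ℕ}
    (hp : ∀ i, p < b i) (h : ∀ i, Sum.elim (fun _ : κ => p) b i < m) :
    index K (blockAlgebra K (Sum.elim (Sum.elim (fun _ : κ => p) b) fun _ : κ => m)) =
      index K (blockAlgebra K (fun _ : κ => p)) + index K (blockAlgebra K b) := by
  rw [← index_prod]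
  apply le_antisymm
  · obtain ⟨f, hf⟩ := exists_index_eq (K := K)
      (L := blockAlgebra K (fun _ : κ => p) × blockAlgebra K b)
    obtain ⟨Γ, hΓ⟩ := traceDual_surjective _ (f ∘ₗ LinearMap.inl K _ _)
    obtain ⟨Δ, hΔ⟩ := traceDual_surjective _ (f ∘ₗ LinearMap.inr K _ _)
    rw [← hf]
    refine (index_le (traceDual _
      (fromBlocks (fromBlocks 0 0 0 Δ) 0 (fromCols 1 0) Γ))).trans (le_of_eq ?_)
    rw [finrank_stabilizer_split hp h _ (toBlocks_fromBlocks₂₁ _ _ _ _)]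
    have : traceDual (Sum.elim (Sum.elim (fun _ : κ => p) b) fun _ : κ => m)
          (fromBlocks (fromBlocks 0 0 0 Δ) 0 (fromCols 1 0) Γ) ∘ₗ
        (splitHom K κ hp h : blockAlgebra K (fun _ : κ => p) × blockAlgebra K b →ₗ[K]
          blockAlgebra K (Sum.elim (Sum.elim (fun _ : κ => p) b) fun _ : κ => m)) = f := by
      rw [← LinearMap.coprod_comp_inl_inr f, ← hΓ, ← hΔ]
      refine LinearMap.ext fun x => ?_
      change trace (fromBlocks (fromBlocks 0 0 0 Δ) 0 (fromCols 1 0) Γ *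
        fromBlocks (fromBlocks x.1.1 0 0 x.2.1) 0 0 x.1.1) =
        trace (Γ * x.1.1) + trace (Δ * x.2.1)
      rw [add_comm]
      simp [fromBlocks_multiply, trace, Fintype.sum_sum_type]
    rw [this]
  · refine le_index_of_eventually fun f => ?_
    obtain ⟨Φ, rfl⟩ := traceDual_surjective _ f
    refine ⟨traceDual _ (fromBlocks 0 0 (fromCols 1 0) 0), ?_⟩
    filter_upwards [eventually_det_add_smul_ne_zero Φ.toBlocks₂₁.toCols₁
      (1 - Φ.toBlocks₂₁.toCols₁) 1 (by simp)] with t ht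
    rw [traceDual_add_smul_sub]
    set Ψ := Φ + t • (fromBlocks 0 0 (fromCols 1 0) 0 - Φ) with hΨ
    have hΨ₁ : Ψ.toBlocks₂₁.toCols₁ =
        Φ.toBlocks₂₁.toCols₁ + t • (1 - Φ.toBlocks₂₁.toCols₁) := by
      ext i j
      rfl
    rw [← hΨ₁] at ht
    clear_value Ψ
    clear hΨ hΨ₁
    set F := Ψ.toBlocks₂₁.toCols₁
    set E := Ψ.toBlocks₂₁.toCols₂
    have hF : F * F⁻¹ = 1 := mul_nonsing_inv _ (isUnit_iff_ne_zero.2 ht)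
    have hF' : F⁻¹ * F = 1 := nonsing_inv_mul _ (isUnit_iff_ne_zero.2 ht)
    -- Column operations, block triangular because the first block precedes the others, bring `(F
    -- E)` to `(1 0)`.
    rw [← finrank_stabilizer_traceDual_conj (Sum.elim (Sum.elim (fun _ : κ => p) b) fun _ : κ => m)
      (fromBlocks (fromBlocks F⁻¹ (-(F⁻¹ * E)) 0 1) 0 0 1)
      (fromBlocks (fromBlocks F E 0 1) 0 0 1)
      ((blockTriangular_fromBlocks_iff (fun i _ => h i)).2
        ⟨(blockTriangular_fromBlocks_iff (fun _ j => hp j)).2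
          ⟨blockTriangular_const p _, rfl, blockTriangular_one⟩, rfl, blockTriangular_const m _⟩)
      ((blockTriangular_fromBlocks_iff (fun i _ => h i)).2
        ⟨(blockTriangular_fromBlocks_iff (fun _ j => hp j)).2
          ⟨blockTriangular_const p _, rfl, blockTriangular_one⟩, rfl, blockTriangular_const m _⟩)
      (by simp [fromBlocks_multiply, hF']),
      finrank_stabilizer_split hp h]
    · exact index_le _
    · have hΨF : Ψ.toBlocks₂₁ = fromCols F E := (fromCols_toCols _).symm
      conv_lhs => rw [← fromBlocks_toBlocks Ψ]
      rw [fromBlocks_multiply, fromBlocks_multiply, toBlocks_fromBlocks₂₁, hΨF]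
      simp [fromCols_mul_fromBlocks, hF, ← Matrix.mul_assoc]

end Reduction

/-! ### A single block: the index of `gl(n)` is `n`. -/

section GeneralLinear

variable {K : Type*} [Field K] {κ : Type*} [Fintype κ] [DecidableEq κ]

theorem mem_stabilizer_traceDual_const {m : ℕ} (Φ : Matrix κ κ K)
    (x : blockAlgebra K (fun _ : κ => m)) :
    x ∈ stabilizer (traceDual _ Φ) ↔ Φ * x.1 = x.1 * Φ := by
  have h : ∀ y : Matrix κ κ K, trace (Φ * (x.1 * y - y * x.1)) =
      trace (Φ * x.1 * y) - trace (x.1 * Φ * y) := by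
    intro y
    rw [mul_sub, trace_sub, ← mul_assoc Φ y, trace_mul_comm (Φ * y), mul_assoc Φ, mul_assoc x.1]
  rw [ext_iff_trace_mul_right]
  constructor
  · intro H y
    exact sub_eq_zero.1 ((h y).symm.trans (H ⟨y, blockTriangular_const m y⟩))
  · intro H y
    exact (h y.1).trans (sub_eq_zero.2 (H y.1))

/-- If the all-ones vector is cyclic for `Φ`, the powers of `Φ` are independent, and they all
commute with `Φ`. -/
theorem card_le_finrank_stabilizer_of_cyclic {m n : ℕ} (e : κ ≃ Fin n) (Φ : Matrix κ κ K)
    (h : (Matrix.of fun j : κ => (Φ ^ (e j : ℕ)) *ᵥ 1).det ≠ 0) :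
    Fintype.card κ ≤ finrank K (stabilizer (traceDual (fun _ : κ => m) Φ)) := by
  let F : κ → stabilizer (traceDual (fun _ : κ => m) Φ) := fun j =>
    ⟨⟨Φ ^ (e j : ℕ), blockTriangular_const m _⟩, (mem_stabilizer_traceDual_const Φ _).2
      ((Commute.refl Φ).pow_right _).eq⟩
  let T : stabilizer (traceDual (fun _ : κ => m) Φ) →ₗ[K] (κ → K) :=
    { toFun := fun x => x.1.1 *ᵥ 1
      map_add' := fun x y => add_mulVec _ _ _
      map_smul' := fun t x => smul_mulVec _ _ _ }
  have hT : LinearIndependent K (T ∘ F) :=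
    linearIndependent_rows_iff_isUnit.2 ((isUnit_iff_isUnit_det _).2 (isUnit_iff_ne_zero.2 h))
  exact (LinearIndependent.of_comp T hT).fintype_card_le_finrank

theorem index_blockAlgebra_const [Infinite K] (m : ℕ) :
    index K (blockAlgebra K (fun _ : κ => m)) = Fintype.card κ := by
  let e := Fintype.equivFin κ
  let δ : κ → K := fun i => Infinite.natEmbedding K (e i)
  have hδ : Function.Injective δ := fun i j hij =>
    e.injective (Fin.ext ((Infinite.natEmbedding K).injective hij))
  apply le_antisymm
  -- The centralizer of a diagonal matrix with distinct entries consists of diagonal matrices.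
  · refine (index_le (traceDual _ (diagonal δ))).trans ?_
    let T : stabilizer (traceDual (fun _ : κ => m) (diagonal δ)) →ₗ[K] (κ → K) :=
      { toFun := fun x => x.1.1.diag
        map_add' := fun x y => rfl
        map_smul' := fun t x => rfl }
    have hT : Function.Injective T := by
      rw [← LinearMap.ker_eq_bot, LinearMap.ker_eq_bot']
      intro x hx
      ext i j
      have h0 : x.1.1 i j = 0 := by
        by_cases hij : i = j
        · subst hij
          exact congrFun hx i
        · have := congrFun (congrFun ((mem_stabilizer_traceDual_const _ x.1).1 x.2) i) j
          rw [diagonal_mul, mul_diagonal, mul_comm, ← sub_eq_zero, ← mul_sub] at this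
          exact (mul_eq_zero.1 this).resolve_right (sub_ne_zero.2 fun H => hij (hδ H))
      exact h0
    simpa using LinearMap.finrank_le_finrank_of_injective hT
  · refine le_index_of_eventually fun f => ?_
    obtain ⟨Φ, rfl⟩ := traceDual_surjective _ f
    refine ⟨traceDual _ (diagonal δ), ?_⟩
    let Q : Matrix κ κ (Polynomial K) := Φ.map Polynomial.C +
      (Polynomial.X : Polynomial K) • (diagonal δ - Φ).map Polynomial.C
    have hQ : ∀ t : K, Q.map (Polynomial.eval t) = Φ + t • (diagonal δ - Φ) := by
      intro t
      ext i j
      simp [Q, mul_comm t]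
    -- The Krylov matrix of the line from `Φ` to `diagonal δ`. At `t = 1` it is a transposed
    -- Vandermonde matrix in the distinct `δ i`, so cyclicity is generic.
    let P : Matrix κ κ (Polynomial K) := Matrix.of fun j => (Q ^ (e j : ℕ)) *ᵥ 1
    have hP : ∀ t : K, P.map (Polynomial.eval t) =
        Matrix.of fun j => ((Φ + t • (diagonal δ - Φ)) ^ (e j : ℕ)) *ᵥ 1 := by
      intro t
      ext j i
      have h1 := RingHom.map_mulVec (Polynomial.evalRingHom t) (Q ^ (e j : ℕ)) 1 i
      have h2 : (Q ^ (e j : ℕ)).map (Polynomial.evalRingHom t) =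
          (Φ + t • (diagonal δ - Φ)) ^ (e j : ℕ) := by
        rw [← hQ]
        exact map_pow (Polynomial.evalRingHom t).mapMatrix Q _
      rw [h2] at h1
      refine h1.trans ?_
      congr 2
      ext
      simp
    filter_upwards [eventually_det_eval_ne_zero P 1 (by
      rw [hP, one_smul, add_sub_cancel]
      have : (Matrix.of fun j : κ => (diagonal δ ^ (e j : ℕ)) *ᵥ 1) =
          ((vandermonde fun i => δ (e.symm i))ᵀ).submatrix e e := by
        ext j i
        simp [diagonal_pow, mulVec_diagonal, vandermonde_apply]
      rw [this, det_submatrix_equiv_self, det_transpose, det_vandermonde_ne_zero_iff]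
      exact hδ.comp e.symm.injective)] with t ht
    rw [traceDual_add_smul_sub]
    rw [hP] at ht
    exact card_le_finrank_stabilizer_of_cyclic e _ ht

end GeneralLinear

/-! ### From labellings to lists of block sizes, and the recursion. -/

section Sizes

/-- The number of indices labelled `j` by `b` is the `j`-th entry of `l`. -/
def HasSizes {ι : Type*} [Fintype ι] (b : ι → ℕ) (l : List ℕ) : Prop :=
  ∀ j, (∑ i, if b i = j then 1 else 0) = l.getD j 0

/-- The standard labelling with block sizes `l`. -/
def blockLabel (l : List ℕ) (x : Σ i : Fin l.length, Fin (l.get i)) : ℕ := x.1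

/-- The index of the algebra of block triangular matrices with block sizes `l`. -/
noncomputable def sizeIndex (K : Type*) [Field K] (l : List ℕ) : ℕ :=
  index K (blockAlgebra K (blockLabel l))

theorem hasSizes_blockLabel (l : List ℕ) : HasSizes (blockLabel l) l := by
  intro j
  rw [Fintype.sum_sigma]
  change (∑ i : Fin l.length, ∑ _x : Fin (l.get i), if (i : ℕ) = j then 1 else 0) = _
  simp only [Finset.sum_const, Finset.card_univ, Fintype.card_fin, smul_eq_mul, mul_ite, mul_one,
    mul_zero]
  by_cases hj : j < l.length
  · rw [Finset.sum_eq_single ⟨j, hj⟩]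
    · simp [hj]
    · intro i _ hi
      exact if_neg fun h => hi (Fin.ext h)
    · simp
  · rw [List.getD_eq_default _ _ (not_lt.1 hj)]
    exact Finset.sum_eq_zero fun i _ => if_neg fun h : (i : ℕ) = j => hj (h ▸ i.2)

theorem card_blockLabel (l : List ℕ) :
    Fintype.card (Σ i : Fin l.length, Fin (l.get i)) = l.sum := by
  simp [Fintype.card_sigma]

theorem blockLabel_lt (l : List ℕ) (x : Σ i : Fin l.length, Fin (l.get i)) :
    blockLabel l x < l.length := x.1.2

variable {K : Type*} [Field K] {ι κ : Type*} [Fintype ι] [Fintype κ]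

theorem HasSizes.append {b : ι → ℕ} {l : List ℕ} (hb : HasSizes b l) :
    HasSizes (Sum.elim b fun _ : κ => l.length) (l ++ [Fintype.card κ]) := by
  intro j
  rw [Fintype.sum_sum_type]
  change (∑ i, if b i = j then 1 else 0) + (∑ _i : κ, if l.length = j then 1 else 0) = _
  simp only [Finset.sum_const, Finset.card_univ, smul_eq_mul]
  rw [hb j]
  rcases lt_trichotomy j l.length with h | h | h
  · rw [List.getD_append _ _ _ _ h, if_neg h.ne']
    simp
  · subst h
    simp
  · rw [List.getD_append_right _ _ _ _ h.le, if_neg h.ne, List.getD_eq_default _ _ h.le,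
      List.getD_eq_default _ _ (by simp; omega)]
    simp

theorem HasSizes.cons {b : ι → ℕ} {l : List ℕ} (hb : HasSizes b l) :
    HasSizes (Sum.elim (fun _ : κ => 0) fun i => b i + 1) (Fintype.card κ :: l) := by
  intro j
  rw [Fintype.sum_sum_type]
  cases j with
  | zero => simp
  | succ j =>
    have := hb j
    simpa using this

theorem HasSizes.index_eq [DecidableEq ι] {b : ι → ℕ} {l : List ℕ} (hb : HasSizes b l) :
    index K (blockAlgebra K b) = sizeIndex K l := by
  have hcard : ∀ j, Nonempty ({i // b i = j} ≃ {i // blockLabel l i = j}) := by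
    intro j
    rw [← Fintype.card_eq, Fintype.card_subtype, Fintype.card_subtype, Finset.card_filter,
      Finset.card_filter, hb, hasSizes_blockLabel]
  let e := ((Equiv.sigmaFiberEquiv b).symm.trans
    (Equiv.sigmaCongrRight fun j => (hcard j).some)).trans (Equiv.sigmaFiberEquiv (blockLabel l))
  have he : ∀ i, blockLabel l (e i) = b i := fun i => ((hcard (b i)).some ⟨i, rfl⟩).2
  exact index_blockAlgebra_congr e fun i j => by rw [he, he]

/-- Entries beyond the list default to 0, so an empty last block is invisible to `HasSizes`. -/
theorem sizeIndex_append_zero (l : List ℕ) : sizeIndex K (l ++ [0]) = sizeIndex K l := by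
  have h : HasSizes (blockLabel l) (l ++ [0]) := by
    intro j
    rw [hasSizes_blockLabel]
    rcases lt_or_ge j l.length with h | h
    · rw [List.getD_append _ _ _ _ h]
    · rw [List.getD_append_right _ _ _ _ h, List.getD_eq_default _ _ h]
      cases j - l.length <;> simp
  rw [← h.index_eq, sizeIndex]

theorem index_parabolic {n : ℕ} (c : Composition n) :
    index K (parabolic K c) = sizeIndex K c.blocks := by
  change index K (blockAlgebra K c.index) = index K (blockAlgebra K (blockLabel c.blocks))
  symm
  exact index_blockAlgebra_congr c.blocksFinEquiv fun i j => by
    change (i.1 : ℕ) < j.1 ↔ c.index (c.embedding i.1 i.2) < c.index (c.embedding j.1 j.2)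
    have hemb : ∀ x : Σ i : Fin c.length, Fin (c.blocksFun i),
        c.index (c.embedding x.1 x.2) = x.1 := fun x => c.index_embedding x.1 x.2
    exact Iff.of_eq (congrArg₂ (fun p q : Fin c.length => p < q) (hemb i).symm (hemb j).symm)

variable [Infinite K]

theorem sizeIndex_append_sum_add (l : List ℕ) (c : ℕ) :
    sizeIndex K (l ++ [l.sum + c]) = sizeIndex K (l ++ [c]) := by
  have h1 := (hasSizes_blockLabel l).append
    (κ := (Σ i : Fin l.length, Fin (l.get i)) ⊕ Fin c)
  have h2 := (hasSizes_blockLabel l).append (κ := Fin c)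
  rw [Fintype.card_sum, card_blockLabel, Fintype.card_fin] at h1
  rw [Fintype.card_fin] at h2
  rw [← h1.index_eq, ← h2.index_eq, index_shrink (blockLabel_lt l)]

theorem sizeIndex_append_mul_sum_add (l : List ℕ) (q c : ℕ) :
    sizeIndex K (l ++ [q * l.sum + c]) = sizeIndex K (l ++ [c]) := by
  induction q with
  | zero => simp
  | succ q ih => rw [← ih, ← sizeIndex_append_sum_add l (q * l.sum + c)]; congr 3; ring

theorem sizeIndex_singleton (N : ℕ) : sizeIndex K [N] = N := by
  have h : HasSizes (fun _ : Fin N => 0) [N] := by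
    intro j
    cases j <;> simp
  rw [← h.index_eq, index_blockAlgebra_const, Fintype.card_fin]

theorem sizeIndex_cons_append (N : ℕ) (l : List ℕ) :
    sizeIndex K (N :: (l ++ [N])) = N + sizeIndex K l := by
  have h := ((hasSizes_blockLabel l).cons (κ := Fin N)).append (κ := Fin N)
  rw [Fintype.card_fin, List.cons_append] at h
  rw [← h.index_eq, index_split (fun i => Nat.succ_pos _), index_blockAlgebra_const,
    Fintype.card_fin, sizeIndex]
  · congr 1
    exact index_blockAlgebra_congr (Equiv.refl _) fun i j => by simp
  · rintro (i | i)
    · simp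
    · simpa using blockLabel_lt l i

/-- The list `(N, N a, …, N a ^ k)`. -/
def geomList (N a k : ℕ) : List ℕ := (List.range (k + 1)).map fun i => N * a ^ i

theorem geomList_succ (N a k : ℕ) : geomList N a (k + 1) = geomList N a k ++ [N * a ^ (k + 1)] := by
  rw [geomList, List.range_succ, List.map_append]
  rfl

theorem geomList_succ' (N a k : ℕ) : geomList N a (k + 1) = N :: geomList (N * a) a k := by
  rw [geomList, List.range_succ_eq_map, List.map_cons, List.map_map]
  simp [geomList, Function.comp_def, pow_succ', mul_assoc]

/-- Puts the next term of the progression in the form `q * sum + c` with `c = N`, so that shrinking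
leaves a last block equal to the first. -/
theorem geomList_sum (N a k : ℕ) (ha : 0 < a) :
    (a - 1) * (geomList N a k).sum + N = N * a ^ (k + 1) := by
  obtain ⟨a, rfl⟩ := Nat.exists_eq_add_of_lt ha
  simp only [zero_add, Nat.add_sub_cancel]
  induction k with
  | zero => simp [geomList]; ring
  | succ k ih =>
    rw [geomList_succ, List.sum_append, mul_add, add_right_comm, ih]
    simp
    ring

theorem sizeIndex_geomList (a : ℕ) (ha : 0 < a) : ∀ k N : ℕ,
    sizeIndex K (geomList N a k) = N * ∑ i ∈ Finset.range (k / 2 + 1), a ^ i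
  | 0, N => by simpa [geomList] using sizeIndex_singleton N
  | 1, N => by
    -- With only two blocks the second is a multiple of the first and shrinks to nothing.
    have h : geomList N a 1 = [N] ++ [a * [N].sum + 0] := by
      simp [geomList, List.range_succ, mul_comm]
    rw [h, sizeIndex_append_mul_sum_add, sizeIndex_append_zero, sizeIndex_singleton]
    simp
  | k + 2, N => by
    -- Shrink the last block to `N`, then split off both outer blocks. What remains starts at `N *
    -- a`, which is why the induction keeps `N` general.
    rw [geomList_succ, ← geomList_sum N a (k + 1) ha, sizeIndex_append_mul_sum_add,
      geomList_succ', List.cons_append, sizeIndex_cons_append, sizeIndex_geomList a ha k,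
      Nat.add_div_right _ two_pos, Finset.sum_range_succ' _ (k / 2 + 1), mul_add,
      Finset.mul_sum, Finset.mul_sum]
    simp only [pow_succ', mul_assoc, pow_zero, mul_one]
    ring

end Sizes

end LieIndex

theorem mainTheorem11 (a k : ℕ) (ha : 1 < a) :
    (LieIndex.index ℂ (LieIndex.parabolic ℂ (LieIndex.powerComposition a k ha)) : ℚ) =
      ((a : ℚ) ^ (k / 2 + 1) - 1) / ((a : ℚ) - 1) := by
  have h : (LieIndex.powerComposition a k ha).blocks = LieIndex.geomList 1 a k := by
    simp [LieIndex.powerComposition, LieIndex.geomList]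
  have ha' : (a : ℚ) ≠ 1 := by exact_mod_cast ha.ne'
  rw [LieIndex.index_parabolic, h, LieIndex.sizeIndex_geomList a (by omega), one_mul,
    ← geom_sum_eq ha']
  push_cast
  rfl
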